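/- Let $\mathbb K=\mathbb R$ or $\mathbb C$. Put $\varphi_1(t)=\frac{t}{e^t-1}$, $\psi(t)=-\frac12(\varphi_1(t)-1)$ and, for $\alpha\in\mathbb K$, $$\beta_\alpha(t)=\varphi_1(-t)\Big(\frac{\varphi_1(t)-1}{t}+\alpha\Big)\in\mathbb K[[t]].$$ Let $G$ be a Lie group over $\mathbb K$ with finite-dimensional Lie algebra $\mathfrak g$, and let $\ln$ be the inverse of the restriction of $\exp:\mathfrak g\to G$ to an open neighbourhood of $0$ on which it is an analytic diffeomorphism onto an open subset of $G$. A solution of the Kashiwara–Vergne conjecture for $G$ is a pair of $\mathfrak g$-valued analytic functions $A,B$ on an open neighbourhood $U$ of $(0,0)$ in $\mathfrak g\times\mathfrak g$ on which the expressions below are defined, with $A(0,0)=B(0,0)=0$ and, for all $(X,Y)\in U$, $$\ln(\exp Y\exp X)-X-Y=(\mathrm{id}-e^{-\mathrm{ad} X})A(X,Y)+(e^{\mathrm{ad} Y}-\mathrm{id})B(X,Y),$$ $$\mathrm{tr}\big(\mathrm{ad}X\circ\delta_1A(X,Y)+\mathrm{ad}Y\circ\delta_2B(X,Y)\big)=\mathrm{tr}\big(\psi(\mathrm{ad}X)+\psi(\mathrm{ad}Y)-\psi(\mathrm{ad}\ln(\exp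 X\exp Y))\big),$$ where $\delta_1A(X,Y):Z\mapsto\frac{d}{dt}A(X+tZ,Y)|_{t=0}$ and $\delta_2B(X,Y):Z\mapsto\frac{d}{dt}B(X,Y+tZ)|_{t=0}$. A universal solution is a pair of Lie series over $\mathbb K$ in two variables $$A(X,Y)=\rho X+\beta(\mathrm{ad}X)(Y)+o(Y),\qquad B(X,Y)=\alpha X+\gamma(\mathrm{ad}X)(Y)+o(Y),$$ with $\rho,\alpha\in\mathbb K$ and $\beta,\gamma\in\mathbb K[[t]]$, such that for every $G$ (and every choice of $\ln$) as above both series converge on some $U$ to a solution. Here $o(Y)$ stands for a series in the Lie polynomials $\mathrm{ad}_{(\mathrm{ad}X)^{j_1}Y}\circ\cdots\circ\mathrm{ad}_{(\mathrm{ad}X)^{j_{k-1}}Y}\big((\mathrm{ad}X)^{j_k}Y\big)$ with $k\ge2$, $j_1,\dots,j_k\ge0$ and $j_{k-1}<j_k$. A universal solution is symmetric if $A(X,Y)=B(-Y,-X)$ and $B(X,Y)=A(-Y,-X)$ as Lie series. **Theorem.** 1. Every universal solution has $\rho=0$, $\beta=\beta_\alpha$ and $$\gamma(t)=\beta_\alpha(t)-\beta_\alpha(0)+\psi'(0)-\psi'(t);$$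 in particular $\gamma$ is uniquely determined by $\alpha$. 2. Every symmetric universal solution has $\alpha=\frac14$. 3. Consequently the symmetric universal solution is unique up to order one in $Y$: any two symmetric universal solutions have the same $\rho,\beta,\alpha,\gamma$, and their $A$'s, as well as their $B$'s, differ by a series of type $o(Y)$. -/

import Mathlib

open scoped Manifold ContDiff

universe u

noncomputable section

namespace KashiwaraVergne

/-! ### Formal power series -/

section PowerSeries

variable (K : Type u) [RCLike K]

/-- `φ₁(t) = t / (e ^ t - 1) = 1 - t / 2 + ⋯`. -/
def phiOne : PowerSeries K := bernoulliPowerSeries K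

/-- `ψ(t) = -(φ₁(t) - 1) / 2`. -/
def psi : PowerSeries K := (-(1 / 2 : K)) • (phiOne K - 1)

/-- `(φ₁(t) - 1) / t`; the constant coefficient of `φ₁` is `1`, so this is the shift of the
coefficients of `φ₁`. -/
def phiOneShift : PowerSeries K := PowerSeries.mk fun n => PowerSeries.coeff (n + 1) (phiOne K)

variable {K}

/-- `β_α(t) = φ₁(-t) ((φ₁(t) - 1) / t + α)`. -/
def betaSeries (α : K) : PowerSeries K :=
  PowerSeries.evalNegHom (phiOne K) * (phiOneShift K + PowerSeries.C α)

end PowerSeries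

/-! ### Lie series in two variables -/

section FreeLie

variable (K : Type u) [RCLike K]

/-- The free Lie algebra on the two generators `x`, `y`. -/
abbrev FreeLie : Type u := FreeLieAlgebra K (Fin 2)

/-- The generator `x`. -/
def genX : FreeLie K := FreeLieAlgebra.of K 0

/-- The generator `y`. -/
def genY : FreeLie K := FreeLieAlgebra.of K 1

/-- `(ad x) ^ j (y)`. -/
def adXY (j : ℕ) : FreeLie K := ((LieAlgebra.ad K (FreeLie K) (genX K)) ^ j) (genY K)

/-- The homogeneous Lie polynomials of total degree `n` of type `o(Y)`: the span of the elements
`ad_{(ad x)^{j₁} y} ∘ ⋯ ∘ ad_{(ad x)^{j_{k-1}} y} ((ad x)^{j_k} y)` of total degree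
`j₁ + ⋯ + j_k + k = n`, where `k ≥ 2` and `j_{k-1} < j_k`. Below, `l` is the list
`j₁, …, j_{k-2}`, while `i = j_{k-1}` and `j = j_k`. -/
def littleOY (n : ℕ) : Submodule K (FreeLie K) :=
  Submodule.span K {w | ∃ (l : List ℕ) (i j : ℕ), i < j ∧
    l.sum + l.length + (i + j + 2) = n ∧
    w = l.foldr (fun p v => ⁅adXY K p, v⁆) ⁅adXY K i, adXY K j⁆}

variable {K}

/-- `F = c X + ξ(ad X)(Y) + o(Y)` for the Lie series `F = ∑ₙ F n`, where `F n` is the homogeneous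
component of total degree `n`. -/
def HasExpansion (F : ℕ → FreeLie K) (c : K) (ξ : PowerSeries K) : Prop :=
  F 0 = 0 ∧ ∀ n : ℕ,
    F (n + 1) - ((if n = 0 then c • genX K else 0) + PowerSeries.coeff n ξ • adXY K n)
      ∈ littleOY K (n + 1)

variable (K) in
/-- The substitution `F(X, Y) ↦ F(-Y, -X)`. -/
def swapNeg : FreeLie K →ₗ⁅K⁆ FreeLie K := FreeLieAlgebra.lift K ![-genY K, -genX K]

/-- The pair of Lie series `(A, B)` is fixed by
`(A(X, Y), B(X, Y)) ↦ (B(-Y, -X), A(-Y, -X))`. -/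
def IsSymmetric (A B : ℕ → FreeLie K) : Prop :=
  ∀ n, swapNeg K (B n) = A n ∧ swapNeg K (A n) = B n

end FreeLie

/-! ### Lie algebras with a norm, and operators on them -/

/-- A Lie ring whose additive group carries a norm. The norm only serves to speak of limits,
derivatives and analytic functions on a finite-dimensional Lie algebra (where all norms are
equivalent and the bracket is continuous); no relation with the bracket is required. -/
class NormedLieRing (𝔤 : Type u) extends NormedAddCommGroup 𝔤, LieRing 𝔤

/-- A Lie algebra over a normed field that is also a normed space. -/
class NormedLieAlgebra (K : Type u) (𝔤 : Type u) [NormedField K] [NormedLieRing 𝔤]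
    extends NormedSpace K 𝔤, LieAlgebra K 𝔤

section Operators

variable (K : Type u) [RCLike K] {𝔤 : Type u} [NormedLieRing 𝔤] [NormedLieAlgebra K 𝔤]
  [FiniteDimensional K 𝔤]

/-- `ad X` as a (continuous) endomorphism of the finite-dimensional Lie algebra `𝔤`. -/
def adL (X : 𝔤) : 𝔤 →L[K] 𝔤 := LinearMap.toContinuousLinearMap (LieAlgebra.ad K 𝔤 X)

variable {K}

/-- The trace of an endomorphism of `𝔤`. -/
def tr (T : 𝔤 →L[K] 𝔤) : K := LinearMap.trace K 𝔤 (T : 𝔤 →ₗ[K] 𝔤)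

/-- The power series `ξ` converges at the endomorphism `T`. -/
def ConvergesAt (ξ : PowerSeries K) (T : 𝔤 →L[K] 𝔤) : Prop :=
  Summable fun n => PowerSeries.coeff n ξ • T ^ n

/-- `ξ(T)`. -/
def evalAt (ξ : PowerSeries K) (T : 𝔤 →L[K] 𝔤) : 𝔤 →L[K] 𝔤 :=
  ∑' n, PowerSeries.coeff n ξ • T ^ n

variable (K)

/-- `δ₁F(X, Y) : Z ↦ d/dt F(X + tZ, Y)` at `t = 0`. -/
def delta1 (F : 𝔤 × 𝔤 → 𝔤) (X Y : 𝔤) : 𝔤 →L[K] 𝔤 := fderiv K (fun X' => F (X', Y)) X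

/-- `δ₂F(X, Y) : Z ↦ d/dt F(X, Y + tZ)` at `t = 0`. -/
def delta2 (F : 𝔤 × 𝔤 → 𝔤) (X Y : 𝔤) : 𝔤 →L[K] 𝔤 := fderiv K (fun Y' => F (X, Y')) Y

end Operators

/-! ### The exponential map of a Lie group and its local inverse -/

section LieGroups

variable {K : Type u} [RCLike K] {𝔤 : Type u} [NormedLieRing 𝔤] [NormedLieAlgebra K 𝔤]
  {E : Type u} [NormedAddCommGroup E] [NormedSpace K E] [CompleteSpace E]
  {G : Type u} [TopologicalSpace G] [ChartedSpace E G] [Group G] [LieGroup 𝓘(K, E) ω G]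

/-- `ex` is the exponential map of the Lie group `G`, where `θ` identifies `𝔤` with the Lie algebra
of `G`: for every `X`, the map `t ↦ ex (t X)` is the one-parameter subgroup of `G` with initial
velocity `X`. -/
def IsLieExp (θ : 𝔤 ≃ₗ⁅K⁆ GroupLieAlgebra 𝓘(K, E) G) (ex : 𝔤 → G) : Prop :=
  ∀ X : 𝔤, (∀ s t : K, ex ((s + t) • X) = ex (s • X) * ex (t • X)) ∧
    HasMFDerivAt 𝓘(K, K) 𝓘(K, E) (fun t : K => ex (t • X)) 0
      (ContinuousLinearMap.toSpanSingleton K (show E from θ X))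

variable (K E) in
/-- `e` is the restriction of the exponential map to an open neighbourhood `𝔤₀ = e.source` of `0`
on which it is an analytic diffeomorphism onto an open subset `e.target` of `G`; the inverse
`e.symm` is the logarithm `ln`. -/
structure IsExpChart (ex : 𝔤 → G) (e : OpenPartialHomeomorph 𝔤 G) : Prop where
  zero_mem : (0 : 𝔤) ∈ e.source
  eqOn : Set.EqOn e ex e.source
  analytic : ContMDiffOn 𝓘(K, 𝔤) 𝓘(K, E) ω e e.source
  analytic_symm : ContMDiffOn 𝓘(K, E) 𝓘(K, 𝔤) ω e.symm e.target

end LieGroups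

/-! ### The Kashiwara–Vergne equations -/

/-- `(A, B)` is a solution on `U` of the Kashiwara–Vergne conjecture for the Lie group `G` with Lie
algebra `𝔤`, exponential map `ex` and logarithm `ln = e.symm`. -/
structure IsKVSolution (K : Type u) [RCLike K] {𝔤 : Type u} [NormedLieRing 𝔤]
    [NormedLieAlgebra K 𝔤] [FiniteDimensional K 𝔤] {G : Type u} [TopologicalSpace G] [Group G]
    (ex : 𝔤 → G) (e : OpenPartialHomeomorph 𝔤 G) (U : Set (𝔤 × 𝔤)) (A B : 𝔤 × 𝔤 → 𝔤) :
    Prop where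
  isOpen : IsOpen U
  zero_mem : (0, 0) ∈ U
  analytic_A : AnalyticOnNhd K A U
  analytic_B : AnalyticOnNhd K B U
  A_zero : A (0, 0) = 0
  B_zero : B (0, 0) = 0
  /-- the logarithms in the equations are defined on `U` -/
  mem_target : ∀ X Y, (X, Y) ∈ U → ex Y * ex X ∈ e.target ∧ ex X * ex Y ∈ e.target
  /-- `ln(exp Y exp X) - X - Y = (id - e^{-ad X}) A(X, Y) + (e^{ad Y} - id) B(X, Y)` -/
  first_eq : ∀ X Y, (X, Y) ∈ U →
    e.symm (ex Y * ex X) - X - Y =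
      (1 - NormedSpace.exp (-adL K X)) (A (X, Y)) + (NormedSpace.exp (adL K Y) - 1) (B (X, Y))
  /-- the operators `ψ(ad X)`, `ψ(ad Y)`, `ψ(ad ln(exp X exp Y))` are defined on `U` -/
  converges : ∀ X Y, (X, Y) ∈ U → ConvergesAt (psi K) (adL K X) ∧ ConvergesAt (psi K) (adL K Y) ∧
    ConvergesAt (psi K) (adL K (e.symm (ex X * ex Y)))
  /-- `tr(ad X ∘ δ₁A + ad Y ∘ δ₂B) = tr(ψ(ad X) + ψ(ad Y) - ψ(ad ln(exp X exp Y)))` -/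
  trace_eq : ∀ X Y, (X, Y) ∈ U →
    tr (adL K X * delta1 K A X Y + adL K Y * delta2 K B X Y) =
      tr (evalAt (psi K) (adL K X) + evalAt (psi K) (adL K Y)
        - evalAt (psi K) (adL K (e.symm (ex X * ex Y))))

/-- The pair of Lie series `A = ρ X + β(ad X)(Y) + o(Y)`, `B = α X + γ(ad X)(Y) + o(Y)` (given by
their homogeneous components `A n`, `B n`) is a universal solution of the Kashiwara–Vergne
conjecture: for every finite-dimensional Lie algebra `𝔤` over `K` and every Lie group `G` with Lie
algebra `𝔤`, the two series converge near `(0, 0)` to a solution. -/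
structure IsUniversalKVSolution {K : Type u} [RCLike K] (A B : ℕ → FreeLie K)
    (ρ : K) (β : PowerSeries K) (α : K) (γ : PowerSeries K) : Prop where
  expansion_A : HasExpansion A ρ β
  expansion_B : HasExpansion B α γ
  solves : ∀ (𝔤 : Type u) [NormedLieRing 𝔤] [NormedLieAlgebra K 𝔤] [FiniteDimensional K 𝔤]
    (E : Type u) [NormedAddCommGroup E] [NormedSpace K E] [CompleteSpace E]
    (G : Type u) [TopologicalSpace G] [T2Space G] [SecondCountableTopology G]
    [ChartedSpace E G] [Group G] [LieGroup 𝓘(K, E) ω G]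
    (θ : 𝔤 ≃ₗ⁅K⁆ GroupLieAlgebra 𝓘(K, E) G) (ex : 𝔤 → G), IsLieExp θ ex →
    ∀ e : OpenPartialHomeomorph 𝔤 G, IsExpChart K E ex e →
    ∃ (U : Set (𝔤 × 𝔤)) (fA fB : 𝔤 × 𝔤 → 𝔤), IsKVSolution K ex e U fA fB ∧
      ∀ X Y, (X, Y) ∈ U →
        HasSum (fun n => FreeLieAlgebra.lift K ![X, Y] (A n)) (fA (X, Y)) ∧
        HasSum (fun n => FreeLieAlgebra.lift K ![X, Y] (B n)) (fB (X, Y))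

end KashiwaraVergne

end

/-!
A universal solution is tested on a single Lie group: `AffGroup K`, the set `K × K` with the
multiplication `(a, b) (a', b') = (a + a', b + e ^ a b')`, whose Lie algebra `AffLie K` has the
bracket `⁅(x, u), (v, w)⁆ = (0, x w - v u)`. Its exponential map is
`(x, u) ↦ (x, u (e ^ x - 1) / x)`, and `ad (x, 0)` is diagonal with eigenvalues `0` and `x`, so a
power series in `ad X` that vanishes for this group vanishes identically.

At `X = (s, u)`, `Y = (s y, t)` every Lie polynomial of type `o(Y)` takes a value `(0, w)` where
`w` is divisible by `y (t - y u)` (`lift_littleOY`). Two evaluations of the equations suffice.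

* At `X = (s, 0)`, `Y = (0, t)` the terms of type `o(Y)` vanish, and the first equation becomes
  `φ₁(s) - 1 = (1 - e ^ (-s)) β(s) - α s`. After clearing the denominator of `φ₁` this is an identity
  of convergent power series (`IsUniversalKVSolution.exp_series_eq`), and `β = β_α` follows by
  cancellation.
* At `X = (s, 0)`, `Y = (s y, 0)` the trace equation becomes an identity of power series in `s`
  whose coefficients are polynomials in `y` (`IsUniversalKVSolution.trace_coeff_eq`). Its terms of
  degree `0` in `y` give `ρ = 0`. The terms of type `o(Y)` contribute to degree at least `2`, so the
  terms of degree `1` give `γ` in terms of `β` and `ψ'`.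

For a symmetric solution, comparing the coefficients of `Y` in total degree one gives
`β(0) = -α`, while `β_α(0) = α - 1 / 2`; hence `α = 1 / 4`. All four of `ρ, β, α, γ` are then
determined, and the uniqueness up to `o(Y)` is read off from the expansions.
-/

noncomputable section

namespace KashiwaraVergne

/-! ### The affine group and its Lie algebra -/

section Affine

variable (K : Type u) [RCLike K]

/-- The nonabelian Lie algebra of dimension two: `K × K` with
`⁅(x, u), (v, w)⁆ = (0, x w - v u)`. -/
def AffLie : Type u := K × K

/-- The Lie group `K × K` with `(a, b) (a', b') = (a + a', b + e ^ a b')`: the simply connected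
cover of the group of affine transformations `z ↦ e ^ a z + b`. -/
def AffGroup : Type u := K × K

instance : NormedAddCommGroup (AffLie K) := inferInstanceAs (NormedAddCommGroup (K × K))

instance : NormedSpace K (AffLie K) := inferInstanceAs (NormedSpace K (K × K))

variable {K}

/-- The element `(x, u)` of `AffLie K`. -/
def affMk (x u : K) : AffLie K := ((x, u) : K × K)

variable (K) in
instance : NormedLieRing (AffLie K) where
  bracket p q := affMk 0 (p.1 * q.2 - q.1 * p.2)
  add_lie p q r := Prod.ext (add_zero (0 : K)).symm <| by
    change (p.1 + q.1) * r.2 - r.1 * (p.2 + q.2) =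
      (p.1 * r.2 - r.1 * p.2) + (q.1 * r.2 - r.1 * q.2)
    ring
  lie_add p q r := Prod.ext (add_zero (0 : K)).symm <| by
    change p.1 * (q.2 + r.2) - (q.1 + r.1) * p.2 =
      (p.1 * q.2 - q.1 * p.2) + (p.1 * r.2 - r.1 * p.2)
    ring
  lie_self p := Prod.ext rfl (sub_self _)
  leibniz_lie p q r := Prod.ext (add_zero (0 : K)).symm <| by
    change p.1 * (q.1 * r.2 - r.1 * q.2) - 0 * p.2 =
      (0 * r.2 - r.1 * (p.1 * q.2 - q.1 * p.2)) + (q.1 * (p.1 * r.2 - r.1 * p.2) - 0 * q.2)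
    ring

instance : NormedLieAlgebra K (AffLie K) where
  lie_smul c p q := Prod.ext (mul_zero c).symm <| by
    change p.1 * (c * q.2) - c * q.1 * p.2 = c * (p.1 * q.2 - q.1 * p.2)
    ring

theorem affMk_add (x u y v : K) : affMk x u + affMk y v = affMk (x + y) (u + v) := rfl

theorem affMk_smul (c x u : K) : c • affMk x u = affMk (c * x) (c * u) := rfl

theorem affMk_lie (x u y v : K) : ⁅affMk x u, affMk y v⁆ = affMk 0 (x * v - y * u) := rfl

instance : FiniteDimensional K (AffLie K) := inferInstanceAs (FiniteDimensional K (K × K))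

instance : TopologicalSpace (AffGroup K) := inferInstanceAs (TopologicalSpace (K × K))

instance : T2Space (AffGroup K) := inferInstanceAs (T2Space (K × K))

instance : SecondCountableTopology (AffGroup K) :=
  inferInstanceAs (SecondCountableTopology (K × K))

instance : ChartedSpace (K × K) (AffGroup K) := inferInstanceAs (ChartedSpace (K × K) (K × K))

instance : IsManifold 𝓘(K, K × K) ω (AffGroup K) :=
  inferInstanceAs (IsManifold 𝓘(K, K × K) ω (K × K))

theorem exp_add_field (x y : K) :
    NormedSpace.exp (x + y) = NormedSpace.exp x * NormedSpace.exp y := by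
  let : NormedAlgebra ℚ K := NormedAlgebra.restrictScalars ℚ ℝ K
  exact NormedSpace.exp_add

instance : Group (AffGroup K) where
  mul p q := ((p.1 + q.1, p.2 + NormedSpace.exp p.1 * q.2) : K × K)
  one := ((0, 0) : K × K)
  inv p := ((-p.1, -(NormedSpace.exp (-p.1) * p.2)) : K × K)
  mul_assoc p q r := Prod.ext (add_assoc _ _ _) <| by
    change p.2 + NormedSpace.exp p.1 * q.2 + NormedSpace.exp (p.1 + q.1) * r.2 =
      p.2 + NormedSpace.exp p.1 * (q.2 + NormedSpace.exp q.1 * r.2)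
    rw [exp_add_field]; ring
  one_mul p := Prod.ext (zero_add _) <| by
    change 0 + NormedSpace.exp (0 : K) * p.2 = p.2
    simp
  mul_one p := Prod.ext (add_zero _) <| by
    change p.2 + NormedSpace.exp p.1 * 0 = p.2
    simp
  inv_mul_cancel p := Prod.ext (neg_add_cancel _) <| by
    change -(NormedSpace.exp (-p.1) * p.2) + NormedSpace.exp (-p.1) * p.2 = 0
    ring

theorem contDiff_exp_field : ContDiff K ω (NormedSpace.exp : K → K) :=
  contDiff_iff_contDiffAt.2 fun x => (NormedSpace.exp_analytic x).contDiffAt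

instance : LieGroup 𝓘(K, K × K) ω (AffGroup K) where
  contMDiff_mul := by
    have hexp := contDiff_exp_field (K := K)
    have h : ContDiff K ω (fun p : (K × K) × (K × K) =>
        ((p.1.1 + p.2.1, p.1.2 + NormedSpace.exp p.1.1 * p.2.2) : K × K)) := by
      fun_prop
    have h' := h.contMDiff
    rw [modelWithCornersSelf_prod, ← chartedSpaceSelf_prod] at h'
    exact h'
  contMDiff_inv := by
    have hexp := contDiff_exp_field (K := K)
    have h : ContDiff K ω (fun p : K × K =>
        ((-p.1, -(NormedSpace.exp (-p.1) * p.2)) : K × K)) := by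
      fun_prop
    exact h.contMDiff

theorem mulInvariantVectorField_affGroup (v : GroupLieAlgebra 𝓘(K, K × K) (AffGroup K))
    (g : AffGroup K) :
    mulInvariantVectorField v g = ((v.1, NormedSpace.exp g.1 * v.2) : K × K) := by
  have h : HasFDerivAt
      (fun p : K × K => ((g.1 + p.1, g.2 + NormedSpace.exp g.1 * p.2) : K × K))
      ((ContinuousLinearMap.fst K K K).prod
        (NormedSpace.exp g.1 • ContinuousLinearMap.snd K K K)) (0, 0) :=
    (hasFDerivAt_fst.const_add g.1).prodMk
      ((hasFDerivAt_snd.const_mul (NormedSpace.exp g.1)).const_add g.2)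
  have h' : mulInvariantVectorField v g = ((ContinuousLinearMap.fst K K K).prod
      (NormedSpace.exp g.1 • ContinuousLinearMap.snd K K K)) v := by
    rw [← h.hasMFDerivAt.mfderiv]; rfl
  rw [h']; rfl

theorem hasFDerivAt_affGroup_vectorField (v : K × K) :
    HasFDerivAt (fun g : K × K => ((v.1, NormedSpace.exp g.1 * v.2) : K × K))
      ((0 : K × K →L[K] K).prod (v.2 • ContinuousLinearMap.fst K K K)) (0, 0) := by
  have h1 : HasDerivAt (NormedSpace.exp : K → K) 1 ((0, 0) : K × K).1 := hasDerivAt_exp_zero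
  have h2 := (h1.comp_hasFDerivAt (f' := ContinuousLinearMap.fst K K K) ((0, 0) : K × K)
    hasFDerivAt_fst).mul_const v.2
  rw [one_smul] at h2
  exact (hasFDerivAt_const v.1 _).prodMk h2

theorem mlieBracket_eq_lieBracket {E : Type*} [NormedAddCommGroup E] [NormedSpace K E]
    (V W : Π x : E, TangentSpace 𝓘(K, E) x) :
    VectorField.mlieBracket 𝓘(K, E) V W = VectorField.lieBracket K V W := by
  rw [← VectorField.mlieBracketWithin_univ, VectorField.mlieBracketWithin_eq_lieBracketWithin]
  exact VectorField.lieBracketWithin_univ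

theorem lieBracket_affGroup_vectorField (v w : K × K) :
    VectorField.lieBracket K (fun g : K × K => ((v.1, NormedSpace.exp g.1 * v.2) : K × K))
      (fun g : K × K => ((w.1, NormedSpace.exp g.1 * w.2) : K × K)) (0, 0) =
      (0, v.1 * w.2 - w.1 * v.2) := by
  rw [VectorField.lieBracket, (hasFDerivAt_affGroup_vectorField w).fderiv,
    (hasFDerivAt_affGroup_vectorField v).fderiv]
  simp [mul_comm]

theorem affGroup_bracket (v w : GroupLieAlgebra 𝓘(K, K × K) (AffGroup K)) :
    ⁅v, w⁆ = ((0, v.1 * w.2 - w.1 * v.2) : K × K) := by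
  have key (v : K × K) : mulInvariantVectorField (I := 𝓘(K, K × K)) (G := AffGroup K) v =
      fun g : K × K => ((v.1, NormedSpace.exp g.1 * v.2) : K × K) :=
    funext fun g => mulInvariantVectorField_affGroup v g
  rw [GroupLieAlgebra.bracket_def, key v, key w]
  exact (congrFun (mlieBracket_eq_lieBracket _ _) _).trans (lieBracket_affGroup_vectorField v w)

variable (K) in
/-- The identity of `K × K`, as an isomorphism of `AffLie K` with the Lie algebra of left invariant
vector fields on `AffGroup K`. -/
def affEquiv : AffLie K ≃ₗ⁅K⁆ GroupLieAlgebra 𝓘(K, K × K) (AffGroup K) where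
  toFun p := p
  invFun p := p
  map_add' _ _ := rfl
  map_smul' _ _ := rfl
  left_inv _ := rfl
  right_inv _ := rfl
  map_lie' {p q} := (affGroup_bracket (K := K) p q).symm

/-! ### The exponential map of the affine group -/

variable (K) in
/-- `(e ^ x - 1) / x`, with the value `1` at `x = 0`. -/
def expQuot : K → K := dslope NormedSpace.exp 0

theorem mul_expQuot (x : K) : x * expQuot K x = NormedSpace.exp x - 1 := by
  simpa [expQuot] using sub_smul_dslope (NormedSpace.exp : K → K) 0 x

theorem expQuot_zero : expQuot K 0 = 1 := by
  rw [expQuot, dslope_same]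
  exact (hasDerivAt_exp_zero (𝕂 := K)).deriv

theorem contDiff_expQuot : ContDiff K ω (expQuot K) := by
  refine contDiff_iff_contDiffAt.2 fun x => ?_
  rcases eq_or_ne x 0 with rfl | hx
  · exact (NormedSpace.exp_hasFPowerSeriesAt_zero (𝕂 := K)
      (𝔸 := K)).has_fpower_series_dslope_fslope.analyticAt.contDiffAt
  · have h : ContDiffAt K ω (fun y : K => (NormedSpace.exp y - 1) / y) x :=
      ((contDiff_exp_field.contDiffAt).sub contDiffAt_const).div contDiffAt_id hx
    refine h.congr_of_eventuallyEq ?_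
    filter_upwards [isOpen_ne.mem_nhds hx] with y hy
    rw [← mul_expQuot, mul_div_cancel_left₀ _ hy]

/-- The exponential map of `AffGroup K`. -/
def affExp (p : AffLie K) : AffGroup K := ((p.1, p.2 * expQuot K p.1) : K × K)

theorem affExp_isLieExp : IsLieExp (affEquiv K) (affExp (K := K)) := by
  intro X
  constructor
  · intro s t
    refine Prod.ext (add_mul s t X.1) ?_
    change (s + t) * X.2 * expQuot K ((s + t) * X.1) =
      s * X.2 * expQuot K (s * X.1) +
        NormedSpace.exp (s * X.1) * (t * X.2 * expQuot K (t * X.1))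
    rcases eq_or_ne X.1 0 with h | h
    · simp [h, expQuot_zero]; ring
    · have h1 := mul_expQuot ((s + t) * X.1)
      have h2 := mul_expQuot (s * X.1)
      have h3 := mul_expQuot (t * X.1)
      rw [add_mul, exp_add_field, ← add_mul] at h1
      apply mul_left_cancel₀ h
      linear_combination X.2 * h1 - X.2 * h2 - NormedSpace.exp (s * X.1) * X.2 * h3
  · have h1 : HasDerivAt (fun t : K => t * X.1) X.1 0 := by
      simpa using (hasDerivAt_id (0 : K)).mul_const X.1
    have h2 : HasDerivAt (fun t : K => t * X.2 * expQuot K (t * X.1)) X.2 0 := by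
      have h3 : HasDerivAt (fun t : K => t * X.2) X.2 0 := by
        simpa using (hasDerivAt_id (0 : K)).mul_const X.2
      have h4 : DifferentiableAt K (fun t : K => expQuot K (t * X.1)) 0 :=
        ((contDiff_expQuot.differentiable (by simp)).comp
          (differentiable_id.mul_const X.1)).differentiableAt
      have h5 := h3.mul h4.hasDerivAt
      rw [zero_mul, zero_mul, expQuot_zero, mul_one, zero_mul, add_zero] at h5
      exact h5
    exact (h1.prodMk h2).hasFDerivAt.hasMFDerivAt

theorem isOpen_expQuot_ne_zero : IsOpen {p : K × K | expQuot K p.1 ≠ 0} :=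
  isOpen_ne_fun (contDiff_expQuot.continuous.comp continuous_fst) continuous_const

variable (K) in
/-- The exponential map of `AffGroup K` on the open set of all `(x, u)` with
`(e ^ x - 1) / x ≠ 0`; it maps this set onto itself. -/
def affChart : OpenPartialHomeomorph (AffLie K) (AffGroup K) where
  toFun := affExp
  invFun p := ((p.1, p.2 / expQuot K p.1) : K × K)
  source := {p : K × K | expQuot K p.1 ≠ 0}
  target := {p : K × K | expQuot K p.1 ≠ 0}
  map_source' _ h := h
  map_target' _ h := h
  left_inv' p h := Prod.ext rfl (mul_div_cancel_right₀ p.2 h)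
  right_inv' p h := Prod.ext rfl (div_mul_cancel₀ p.2 h)
  open_source := isOpen_expQuot_ne_zero
  open_target := isOpen_expQuot_ne_zero
  continuousOn_toFun := by
    have h := contDiff_expQuot (K := K)
    have : ContDiff K ω (fun p : K × K => ((p.1, p.2 * expQuot K p.1) : K × K)) := by fun_prop
    exact this.continuous.continuousOn
  continuousOn_invFun := by
    have h := (contDiff_expQuot (K := K)).continuous
    exact continuous_fst.continuousOn.prodMk
      (continuous_snd.continuousOn.div (h.comp continuous_fst).continuousOn fun _ hp => hp)

theorem affChart_isExpChart : IsExpChart K (K × K) (affExp (K := K)) (affChart K) where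
  zero_mem := by
    change expQuot K 0 ≠ 0
    rw [expQuot_zero]; exact one_ne_zero
  eqOn _ _ := rfl
  analytic := by
    have h := contDiff_expQuot (K := K)
    have : ContDiff K ω (fun p : K × K => ((p.1, p.2 * expQuot K p.1) : K × K)) := by fun_prop
    exact this.contMDiff.contMDiffOn
  analytic_symm := by
    have h : ContDiffOn K ω (fun p : K × K => ((p.1, p.2 / expQuot K p.1) : K × K))
        {p : K × K | expQuot K p.1 ≠ 0} :=
      contDiff_fst.contDiffOn.prodMk (contDiff_snd.contDiffOn.div
        (contDiff_expQuot.comp contDiff_fst).contDiffOn fun _ hp => hp)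
    exact h.contMDiffOn

end Affine

/-! ### Lie series in the affine Lie algebra -/

section LieSeries

variable {K : Type u} [RCLike K]

theorem lift_genX (X Y : AffLie K) : FreeLieAlgebra.lift K ![X, Y] (genX K) = X := by
  simp [genX]

theorem lift_genY (X Y : AffLie K) : FreeLieAlgebra.lift K ![X, Y] (genY K) = Y := by
  simp [genY]

theorem adXY_succ (n : ℕ) : adXY K (n + 1) = ⁅genX K, adXY K n⁆ := by
  rw [adXY, pow_succ']; rfl

theorem lift_adXY_succ (s u y t : K) (n : ℕ) :
    FreeLieAlgebra.lift K ![affMk s u, affMk (s * y) t] (adXY K (n + 1)) =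
      affMk 0 (s ^ (n + 1) * (t - y * u)) := by
  induction n with
  | zero =>
    rw [adXY_succ, LieHom.map_lie, lift_genX]
    change ⁅_, FreeLieAlgebra.lift K _ (genY K)⁆ = _
    rw [lift_genY, affMk_lie]
    congr 1; ring
  | succ n ih =>
    rw [adXY_succ, LieHom.map_lie, lift_genX, ih, affMk_lie]
    congr 1; ring

theorem lift_adXY_zero (X Y : AffLie K) : FreeLieAlgebra.lift K ![X, Y] (adXY K 0) = Y :=
  lift_genY X Y

/-- The Lie monomials spanning `littleOY`, at `X = (s, u)`, `Y = (s y, t)`. Here `(ad X) ^ j Y` is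
`(0, s ^ j (t - y u))` for `j ≥ 1`, and `ad Y` acts on such elements by `s y`; so a monomial
vanishes unless all indices but the last are `0`, and then there is at least one factor `ad Y`. -/
theorem lift_foldr_adXY (l : List ℕ) (i j : ℕ) (hij : i < j) :
    ∃ p : Polynomial K, ∀ s u y t : K,
      FreeLieAlgebra.lift K ![affMk s u, affMk (s * y) t]
        (l.foldr (fun p v => ⁅adXY K p, v⁆) ⁅adXY K i, adXY K j⁆) =
      affMk 0 (s ^ (l.sum + l.length + (i + j + 1)) * (y * p.eval y * (t - y * u))) := by
  induction l with
  | nil =>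
    obtain ⟨j, rfl⟩ := Nat.exists_eq_succ_of_ne_zero hij.ne_bot
    rcases i with _ | i
    · refine ⟨1, fun s u y t => ?_⟩
      rw [List.foldr_nil, LieHom.map_lie, lift_adXY_zero, lift_adXY_succ, affMk_lie]
      congr 1; simp; ring
    · refine ⟨0, fun s u y t => ?_⟩
      rw [List.foldr_nil, LieHom.map_lie, lift_adXY_succ, lift_adXY_succ, affMk_lie]
      congr 1; simp
  | cons q l ih =>
    obtain ⟨p, hp⟩ := ih
    rcases q with _ | q
    · refine ⟨Polynomial.X * p, fun s u y t => ?_⟩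
      rw [List.foldr_cons, LieHom.map_lie, lift_adXY_zero, hp, affMk_lie]
      congr 1; simp; ring
    · refine ⟨0, fun s u y t => ?_⟩
      rw [List.foldr_cons, LieHom.map_lie, lift_adXY_succ, hp, affMk_lie]
      congr 1; simp

/-- The Lie polynomials of type `o(Y)` have values of the form `(0, w)` at `X = (s, u)`,
`Y = (s y, t)`. With the first coordinate of `Y` scaled by `s`, homogeneity puts the dependence on
`s` into a single power, and the rest is a polynomial in `y` divisible by `y` times `t - y u`. -/
theorem lift_littleOY {n : ℕ} {w : FreeLie K} (hw : w ∈ littleOY K (n + 1)) :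
    ∃ p : Polynomial K, ∀ s u y t : K,
      FreeLieAlgebra.lift K ![affMk s u, affMk (s * y) t] w =
        affMk 0 (s ^ n * (y * p.eval y * (t - y * u))) := by
  induction hw using Submodule.span_induction with
  | mem w h =>
    obtain ⟨l, i, j, hij, hn, rfl⟩ := h
    obtain ⟨p, hp⟩ := lift_foldr_adXY (K := K) l i j hij
    refine ⟨p, fun s u y t => ?_⟩
    rw [hp, show l.sum + l.length + (i + j + 1) = n by omega]
  | zero =>
    refine ⟨0, fun s u y t => ?_⟩
    rw [map_zero]; simp [affMk]; rfl
  | add v w _ _ hv hw =>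
    obtain ⟨p, hp⟩ := hv
    obtain ⟨q, hq⟩ := hw
    refine ⟨p + q, fun s u y t => ?_⟩
    rw [map_add, hp, hq, affMk_add, Polynomial.eval_add]
    congr 1 <;> ring
  | smul c w _ hw =>
    obtain ⟨p, hp⟩ := hw
    refine ⟨Polynomial.C c * p, fun s u y t => ?_⟩
    rw [map_smul, hp, affMk_smul, Polynomial.eval_mul, Polynomial.eval_C]
    congr 1 <;> ring

/-- The components of a Lie series `c X + ξ(ad X)(Y) + o(Y)` at `((s, u), (s y, t))`. -/
theorem HasExpansion.lift_succ {F : ℕ → FreeLie K} {c : K} {ξ : PowerSeries K}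
    (h : HasExpansion F c ξ) (n : ℕ) :
    ∃ p : Polynomial K, ∀ s u y t : K,
      FreeLieAlgebra.lift K ![affMk s u, affMk (s * y) t] (F (n + 1)) =
        affMk (if n = 0 then c * s + PowerSeries.coeff 0 ξ * (s * y) else 0)
          (s ^ n * ((if n = 0 then c * u else 0) +
            PowerSeries.coeff n ξ * (t - if n = 0 then 0 else y * u) +
            y * p.eval y * (t - y * u))) := by
  obtain ⟨p, hp⟩ := lift_littleOY (h.2 n)
  refine ⟨p, fun s u y t => ?_⟩
  have h1 := hp s u y t
  rw [map_sub, sub_eq_iff_eq_add, map_add] at h1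
  rw [h1, map_smul]
  rcases n with _ | n
  · rw [if_pos rfl, map_smul, lift_genX, lift_adXY_zero]
    simp only [affMk_smul, affMk_add, if_true]
    congr 1 <;> ring
  · rw [if_neg n.succ_ne_zero, map_zero, zero_add, lift_adXY_succ]
    simp only [affMk_smul, affMk_add, n.succ_ne_zero, if_false]
    congr 1 <;> ring

end LieSeries

/-! ### Functions with a power series expansion at zero -/

section HasEval

variable {K : Type u} [RCLike K]

/-- The power series `p` converges to `f s` for all `s` near `0`. -/
def HasEval (p : PowerSeries K) (f : K → K) : Prop :=
  ∀ᶠ s in nhds (0 : K), HasSum (fun n => PowerSeries.coeff n p * s ^ n) (f s)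

namespace HasEval

variable {p q : PowerSeries K} {f g : K → K}

theorem congr (hp : HasEval p f) (h : f =ᶠ[nhds 0] g) : HasEval p g := by
  filter_upwards [hp, h] with s h1 h2
  rwa [← h2]

theorem sub (hp : HasEval p f) (hq : HasEval q g) : HasEval (p - q) (fun s => f s - g s) := by
  filter_upwards [hp, hq] with s h1 h2
  simpa [sub_mul] using HasSum.sub h1 h2

theorem mul (hp : HasEval p f) (hq : HasEval q g) : HasEval (p * q) (fun s => f s * g s) := by
  filter_upwards [hp, hq] with s h1 h2
  have n1 := h1.summable.norm
  have n2 := h2.summable.norm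
  have h3 := (summable_norm_sum_mul_antidiagonal_of_summable_norm n1 n2).of_norm.hasSum
  rw [← tsum_mul_tsum_eq_tsum_sum_antidiagonal_of_summable_norm n1 n2, h1.tsum_eq,
    h2.tsum_eq] at h3
  refine h3.congr_fun fun n => ?_
  rw [PowerSeries.coeff_mul, Finset.sum_mul]
  refine Finset.sum_congr rfl fun ij hij => ?_
  rw [← Finset.HasAntidiagonal.mem_antidiagonal.1 hij, pow_add]
  ring

theorem X : HasEval (PowerSeries.X : PowerSeries K) (fun s => s) := by
  refine Filter.Eventually.of_forall fun s => ?_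
  have h := hasSum_single
    (f := fun n => PowerSeries.coeff n (PowerSeries.X : PowerSeries K) * s ^ n) 1 fun n hn => by simp [PowerSeries.coeff_X, hn]
  simpa using h

theorem C (c : K) : HasEval (PowerSeries.C c) (fun _ => c) := by
  refine Filter.Eventually.of_forall fun s => ?_
  have h := hasSum_single (f := fun n => PowerSeries.coeff n (PowerSeries.C c) * s ^ n)
    0 fun n hn => by simp [PowerSeries.coeff_C, hn]
  simpa using h

theorem exp : HasEval (PowerSeries.exp K) NormedSpace.exp := by
  refine Filter.Eventually.of_forall fun s => ?_
  have h := NormedSpace.exp_series_hasSum_exp' (𝕂 := K) s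
  simpa [PowerSeries.coeff_exp] using h

theorem comp_neg (hp : HasEval p f) : HasEval (PowerSeries.evalNegHom p) (fun s => f (-s)) := by
  have h : Filter.Tendsto (fun s : K => -s) (nhds 0) (nhds 0) := by
    simpa using (continuous_neg (G := K)).tendsto 0
  filter_upwards [h.eventually hp] with s hs
  convert hs using 2 with n
  rw [PowerSeries.evalNegHom, PowerSeries.coeff_rescale, neg_pow s]
  ring

theorem unique (hp : HasEval p f) (hq : HasEval q f) : p = q := by
  have key {r : PowerSeries K} (hr : HasEval r f) : HasFPowerSeriesAt f
      (FormalMultilinearSeries.ofScalars K fun n => PowerSeries.coeff n r) 0 := by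
    rw [hasFPowerSeriesAt_iff]
    filter_upwards [hr] with s hs
    simpa [FormalMultilinearSeries.coeff_ofScalars, mul_comm] using hs
  ext n
  have h := congrArg (fun r => r.coeff n) ((key hp).eq_formalMultilinearSeries (key hq))
  simpa [FormalMultilinearSeries.coeff_ofScalars] using h

end HasEval

end HasEval

/-! ### Linear operators on the affine Lie algebra -/

section Operators

variable {K : Type u} [RCLike K]

instance : CompleteSpace (AffLie K) := inferInstanceAs (CompleteSpace (K × K))

variable (K) in
/-- The first coordinate on `AffLie K`. -/
def affFst : AffLie K →L[K] K := ContinuousLinearMap.fst K K K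

variable (K) in
/-- The second coordinate on `AffLie K`. -/
def affSnd : AffLie K →L[K] K := ContinuousLinearMap.snd K K K

@[simp] theorem affFst_affMk (x u : K) : affFst K (affMk x u) = x := rfl

@[simp] theorem affSnd_affMk (x u : K) : affSnd K (affMk x u) = u := rfl

theorem affMk_eta (p : AffLie K) : affMk (affFst K p) (affSnd K p) = p := rfl

theorem tr_affLie (T : AffLie K →L[K] AffLie K) :
    tr T = affFst K (T (affMk 1 0)) + affSnd K (T (affMk 0 1)) := by
  let b : Module.Basis (Fin 2) K (AffLie K) := Module.Basis.finTwoProd K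
  have h0 : b 0 = affMk 1 0 := Module.Basis.finTwoProd_zero K
  have h1 : b 1 = affMk 0 1 := Module.Basis.finTwoProd_one K
  rw [tr, LinearMap.trace_eq_matrix_trace K b, Matrix.trace_fin_two, LinearMap.toMatrix_apply,
    LinearMap.toMatrix_apply, h0, h1]
  rfl

theorem hasSum_affSnd_apply {ι : Type*} {f : ι → AffLie K →L[K] AffLie K}
    {T : AffLie K →L[K] AffLie K} (h : HasSum f T) (v : AffLie K) :
    HasSum (fun i => affSnd K (f i v)) (affSnd K (T v)) :=
  h.mapL ((affSnd K).comp (ContinuousLinearMap.apply K (AffLie K) v))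

theorem hasSum_tr {ι : Type*} {f : ι → AffLie K →L[K] AffLie K}
    {T : AffLie K →L[K] AffLie K} (h : HasSum f T) : HasSum (fun i => tr (f i)) (tr T) := by
  simp only [tr_affLie]
  exact (h.mapL ((affFst K).comp (ContinuousLinearMap.apply K (AffLie K) (affMk 1 0)))).add
    (hasSum_affSnd_apply h (affMk 0 1))

theorem adL_affMk (x u v w : K) : adL K (affMk x u) (affMk v w) = affMk 0 (x * w - v * u) := rfl

theorem affSnd_neg_adL_pow (x v w : K) (n : ℕ) :
    affSnd K (((-adL K (affMk x 0)) ^ n) (affMk v w)) = (-x) ^ n * w := by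
  induction n generalizing v w with
  | zero => simp
  | succ n ih =>
    rw [pow_succ, mul_apply_eq_comp, neg_apply, adL_affMk]
    have : -affMk 0 (x * w - v * 0) = affMk 0 (-x * w) := by
      rw [← neg_one_smul K, affMk_smul]; congr 1 <;> ring
    rw [this, ih]; ring

theorem affSnd_exp_neg_adL (x v w : K) :
    affSnd K (NormedSpace.exp (-adL K (affMk x 0)) (affMk v w)) = NormedSpace.exp (-x) * w := by
  have h1 := hasSum_affSnd_apply
    (NormedSpace.exp_series_hasSum_exp' (𝕂 := K) (-adL K (affMk x 0))) (affMk v w)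
  have h2 := (NormedSpace.exp_series_hasSum_exp' (𝕂 := K) (-x)).mul_right w
  refine h1.unique (h2.congr_fun fun n => ?_)
  rw [smul_apply, map_smul, affSnd_neg_adL_pow, smul_eq_mul, smul_eq_mul,
    mul_assoc]

theorem affSnd_exp_adL (t v w : K) :
    affSnd K (NormedSpace.exp (adL K (affMk 0 t)) (affMk v w)) = w - t * v := by
  have h1 := hasSum_affSnd_apply
    (NormedSpace.exp_series_hasSum_exp' (𝕂 := K) (adL K (affMk 0 t))) (affMk v w)
  have h0 (n : ℕ) : ((adL K (affMk 0 t)) ^ (n + 2)) (affMk v w) = 0 := by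
    rw [pow_add, mul_apply_eq_comp, pow_two, mul_apply_eq_comp,
      adL_affMk, adL_affMk]
    simp only [zero_mul, sub_zero]
    exact map_zero _
  have h2 := hasSum_sum_of_ne_finset_zero (L := .unconditional ℕ) (s := Finset.range 2)
    (f := fun n : ℕ => affSnd K (((n.factorial : K)⁻¹ • (adL K (affMk 0 t)) ^ n) (affMk v w)))
    fun n hn => by
      obtain ⟨m, rfl⟩ := Nat.exists_eq_add_of_le' (not_lt.1 (Finset.mem_range.not.1 hn))
      rw [smul_apply, h0, smul_zero, map_zero]
  rw [h1.unique h2]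
  simp [Finset.sum_range_succ, adL_affMk]
  ring

theorem tr_adL_pow_succ (x : K) (n : ℕ) : tr (adL K (affMk x 0) ^ (n + 1)) = x ^ (n + 1) := by
  have h (v w : K) : (adL K (affMk x 0) ^ (n + 1)) (affMk v w) = affMk 0 (x ^ (n + 1) * w) := by
    induction n with
    | zero => rw [zero_add, pow_one, adL_affMk]; congr 1; ring
    | succ n ih =>
      rw [pow_succ', mul_apply_eq_comp, ih, adL_affMk]; congr 1; ring
  rw [tr_affLie, h, h]
  simp

theorem hasSum_tr_evalAt {ξ : PowerSeries K} (h0 : PowerSeries.coeff 0 ξ = 0) {x : K}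
    (h : ConvergesAt ξ (adL K (affMk x 0))) :
    HasSum (fun n => PowerSeries.coeff n ξ * x ^ n) (tr (evalAt ξ (adL K (affMk x 0)))) := by
  have h1 := hasSum_tr h.hasSum
  refine h1.congr_fun fun n => ?_
  rcases n with _ | n
  · simp [h0, tr]
  · rw [← tr_adL_pow_succ]; simp [tr]

end Operators

/-! ### The Kashiwara–Vergne equations on the affine group -/

section Equations

variable {K : Type u} [RCLike K]

theorem continuous_affMk : Continuous fun p : K × K => affMk p.1 p.2 := continuous_id

theorem affExp_mul_affExp_eq (s t : K) :
    (affChart K).symm (affExp (affMk 0 t) * affExp (affMk s 0)) =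
      affMk s (t / expQuot K s) := by
  change affMk (0 + s) ((t * expQuot K 0 + NormedSpace.exp 0 * (0 * expQuot K s)) /
    expQuot K (0 + s)) = _
  rw [zero_add, expQuot_zero]
  simp

theorem affExp_mul_affExp_of_snd_eq_zero (s t : K) :
    (affChart K).symm (affExp (affMk s 0) * affExp (affMk t 0)) = affMk (s + t) 0 := by
  change affMk (s + t) ((0 * expQuot K s + NormedSpace.exp s * (0 * expQuot K t)) /
    expQuot K (s + t)) = _
  simp

/-- If the values of a differentiable function `h` near `0` are sums `∑ₙ c n * τ`, then
`h' 0 = ∑ₙ c n`. -/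
theorem hasSum_of_hasDerivAt {c : ℕ → K} {h : K → K} {h' : K}
    (hs : ∀ᶠ τ in nhds (0 : K), HasSum (fun n => c n * τ) (h τ)) (hd : HasDerivAt h h' 0) :
    HasSum c h' := by
  obtain ⟨τ, hτ, hτ0⟩ :=
    ((hs.filter_mono nhdsWithin_le_nhds).and (self_mem_nhdsWithin (s := {0}ᶜ))).exists
  have hc : Summable c := by
    have h1 := hτ.summable.mul_right τ⁻¹
    simpa [mul_assoc, mul_inv_cancel₀ (show τ ≠ 0 from hτ0)] using h1
  have h2 : h =ᶠ[nhds 0] fun τ => (∑' n, c n) * τ := by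
    filter_upwards [hs] with σ hσ
    exact hσ.unique (hc.hasSum.mul_right σ)
  have h3 : HasDerivAt (fun τ : K => (∑' n, c n) * τ) (∑' n, c n) 0 := by
    simpa using (hasDerivAt_id (0 : K)).const_mul (∑' n, c n)
  rw [hd.unique (h3.congr_of_eventuallyEq h2)]
  exact hc.hasSum

theorem hasSum_lift_of_hasSum_succ {F : ℕ → FreeLie K} {c : K} {ξ : PowerSeries K}
    (hF : HasExpansion F c ξ) {X Y v : AffLie K}
    (h : HasSum (fun n => FreeLieAlgebra.lift K ![X, Y] (F n)) v) :
    HasSum (fun n => FreeLieAlgebra.lift K ![X, Y] (F (n + 1))) v := by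
  rw [← hasSum_nat_add_iff' 1] at h
  simpa [hF.1] using h

/-- For a Lie series `F = c X + ξ(ad X)(Y) + o(Y)` whose `o(Y)` part is described by the polynomials
`p n`, the second coordinate of `F (n + 1)` at `X = (s, u)`, `Y = (s y, t)` is
`s ^ n * sndCoeff c ξ p y u t n`. -/
def sndCoeff (c : K) (ξ : PowerSeries K) (p : ℕ → Polynomial K) (y u t : K) (n : ℕ) : K :=
  (if n = 0 then c * u else 0) +
    PowerSeries.coeff n ξ * (t - if n = 0 then 0 else y * u) + y * (p n).eval y * (t - y * u)

theorem HasExpansion.hasSum_affLie {F : ℕ → FreeLie K} {c : K} {ξ : PowerSeries K}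
    (hF : HasExpansion F c ξ) :
    ∃ p : ℕ → Polynomial K, ∀ (s u y t : K) (v : AffLie K),
      HasSum (fun n => FreeLieAlgebra.lift K ![affMk s u, affMk (s * y) t] (F n)) v →
      affFst K v = c * s + PowerSeries.coeff 0 ξ * (s * y) ∧
      HasSum (fun n => s ^ n * sndCoeff c ξ p y u t n) (affSnd K v) := by
  choose p hp using hF.lift_succ
  refine ⟨p, fun s u y t v hv => ?_⟩
  have h := hasSum_lift_of_hasSum_succ hF hv
  simp only [hp] at h
  constructor
  · have h1 := h.mapL (affFst K)
    simp only [affFst_affMk] at h1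
    have h2 := hasSum_ite_eq (L := .unconditional ℕ) 0 (c * s + PowerSeries.coeff 0 ξ * (s * y))
    exact h1.unique h2
  · exact h.mapL (affSnd K)

variable {A B : ℕ → FreeLie K} {ρ α : K} {β γ : PowerSeries K}

/-- The second coordinate of the first Kashiwara–Vergne equation at `X = (s, 0)`, `Y = (0, t)`,
multiplied by `e ^ s - 1` and divided by `t`. -/
theorem IsUniversalKVSolution.exp_series_eq (h : IsUniversalKVSolution A B ρ β α γ) :
    PowerSeries.X - (PowerSeries.exp K - 1) =
      (PowerSeries.exp K - 1) * (1 - PowerSeries.evalNegHom (PowerSeries.exp K)) * β -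
        PowerSeries.C α * PowerSeries.X * (PowerSeries.exp K - 1) := by
  obtain ⟨U, fA, fB, hU, hs⟩ := h.solves (AffLie K) (K × K) (AffGroup K) (affEquiv K) affExp
    affExp_isLieExp (affChart K) affChart_isExpChart
  have hnear : ∀ᶠ q : K × K in nhds (0, 0), (affMk q.2 0, affMk 0 q.1) ∈ U := by
    have hc : Continuous fun q : K × K => (affMk q.2 0, affMk 0 q.1) :=
      (continuous_affMk.comp (continuous_snd.prodMk continuous_const)).prodMk
        (continuous_affMk.comp (continuous_const.prodMk continuous_fst))
    exact hc.continuousAt.eventually (hU.isOpen.mem_nhds hU.zero_mem)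
  -- A fixed `t ≠ 0` for which `(X, Y)` lies in `U` for all small `s`.
  obtain ⟨t, ht, ht0⟩ := ((hnear.curry_nhds.filter_mono nhdsWithin_le_nhds).and
    (self_mem_nhdsWithin (s := {0}ᶜ))).exists
  replace ht0 : t ≠ 0 := ht0
  obtain ⟨p, hp⟩ := h.expansion_A.hasSum_affLie
  obtain ⟨q, hq⟩ := h.expansion_B.hasSum_affLie
  have hX := HasEval.X (K := K)
  have hE := (HasEval.exp (K := K)).sub (HasEval.C 1)
  have hE' := (HasEval.C 1).sub (HasEval.exp (K := K)).comp_neg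
  have hβ : HasEval β (fun s => affSnd K (fA (affMk s 0, affMk 0 t)) / t) := by
    filter_upwards [ht] with s hsU
    have h1 := (hs _ _ hsU).1
    -- `hp` expects the first coordinate of `Y` in the form `s * y`; here `y = 0`.
    rw [← mul_zero s] at h1
    have h2 := ((hp s (s * 0) 0 t _ h1).2).div_const t
    rw [mul_zero] at h2
    refine h2.congr_fun fun n => ?_
    simp only [sndCoeff]
    field_simp
    simp
    ring
  have hL := hX.sub hE
  have hR := ((hE.mul hE').mul hβ).sub (((HasEval.C α).mul hX).mul hE)
  rw [map_one] at hL hR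
  refine hL.unique (hR.congr ?_)
  filter_upwards [ht] with s hsU
  have h1 := hs _ _ hsU
  rw [← mul_zero s] at h1
  have hB := (hq s (s * 0) 0 t _ h1.2).1
  rw [mul_zero, mul_zero, add_zero] at hB
  have h2 := congrArg (affSnd K) (hU.first_eq _ _ hsU)
  have hg : expQuot K s ≠ 0 := by
    have := (hU.mem_target _ _ hsU).1
    change expQuot K (0 + s) ≠ 0 at this
    rwa [zero_add] at this
  rw [affExp_mul_affExp_eq, map_sub, map_sub, map_add, sub_apply, sub_apply, map_sub, map_sub,
    ← affMk_eta (fA _), ← affMk_eta (fB _), affSnd_exp_neg_adL, affSnd_exp_adL, hB] at h2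
  simp only [one_apply_eq_self, affSnd_affMk] at h2
  have h3 := mul_expQuot s
  rw [← h3]
  field_simp at h2 ⊢
  linear_combination (-s) * h2

/-- The coefficient of `s ^ (n + 1)` in the trace equation at `X = (s, 0)`, `Y = (s y, 0)`. -/
theorem IsUniversalKVSolution.trace_coeff_eq (h : IsUniversalKVSolution A B ρ β α γ) :
    ∃ p q : ℕ → Polynomial K, ∀ (y : K) (n : ℕ),
      sndCoeff ρ β p y 1 0 n + y * sndCoeff α γ q y 0 1 n =
        PowerSeries.coeff (n + 1) (psi K) * (1 + y ^ (n + 1) - (1 + y) ^ (n + 1)) := by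
  obtain ⟨U, fA, fB, hU, hs⟩ := h.solves (AffLie K) (K × K) (AffGroup K) (affEquiv K) affExp
    affExp_isLieExp (affChart K) affChart_isExpChart
  obtain ⟨p, hp⟩ := h.expansion_A.hasSum_affLie
  obtain ⟨q, hq⟩ := h.expansion_B.hasSum_affLie
  refine ⟨p, q, fun y n => ?_⟩
  have hnear : ∀ᶠ s in nhds (0 : K), (affMk s 0, affMk (s * y) 0) ∈ U := by
    have hc : Continuous fun s : K => (affMk s 0, affMk (s * y) 0) :=
      (continuous_affMk.comp (continuous_id.prodMk continuous_const)).prodMk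
        (continuous_affMk.comp ((continuous_id.mul continuous_const).prodMk continuous_const))
    have h0 : (affMk 0 0, affMk (0 * y) 0) ∈ U := by
      rw [zero_mul]; exact hU.zero_mem
    exact hc.continuousAt.eventually (hU.isOpen.mem_nhds h0)
  -- The constant term of `ψ` would contribute the dimension `2` to the traces.
  have hψ0 : PowerSeries.coeff 0 (psi K) = 0 := by
    simp [psi, phiOne, bernoulliPowerSeries]
  have hl : HasEval (PowerSeries.X * PowerSeries.mk fun n =>
      sndCoeff ρ β p y 1 0 n + y * sndCoeff α γ q y 0 1 n)
      (fun s => tr (adL K (affMk s 0) * delta1 K fA (affMk s 0) (affMk (s * y) 0) +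
        adL K (affMk (s * y) 0) * delta2 K fB (affMk s 0) (affMk (s * y) 0))) := by
    -- `tr (ad (x, 0) * T)` is `x` times the `(2, 2)` entry of `T`, so only derivatives in the
    -- direction `(0, 1)` matter; in that direction the second coordinates of `A`, `B` are linear.
    have key : ∀ᶠ s in nhds (0 : K), HasSum (fun n => PowerSeries.coeff n (PowerSeries.mk fun n =>
      sndCoeff ρ β p y 1 0 n + y * sndCoeff α γ q y 0 1 n) * s ^ n)
      (affSnd K (delta1 K fA (affMk s 0) (affMk (s * y) 0) (affMk 0 1)) +
        y * affSnd K (delta2 K fB (affMk s 0) (affMk (s * y) 0) (affMk 0 1))) := by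
      filter_upwards [hnear] with s hsU
      have hline : HasDerivAt (fun τ : K => affMk s τ) (affMk 0 1) 0 :=
        (hasDerivAt_const (0 : K) s).prodMk (hasDerivAt_id (0 : K))
      have hline' : HasDerivAt (fun τ : K => affMk (s * y) τ) (affMk 0 1) 0 :=
        (hasDerivAt_const (0 : K) (s * y)).prodMk (hasDerivAt_id (0 : K))
      have hdA : DifferentiableAt K (fun X => fA (X, affMk (s * y) 0)) (affMk s 0) :=
        (hU.analytic_A _ hsU).differentiableAt.comp (affMk s 0)
          (differentiableAt_id.prodMk (differentiableAt_const _))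
      have hdB : DifferentiableAt K (fun Y => fB (affMk s 0, Y)) (affMk (s * y) 0) :=
        (hU.analytic_B _ hsU).differentiableAt.comp (affMk (s * y) 0)
          ((differentiableAt_const _).prodMk differentiableAt_id)
      have hA : HasDerivAt (fun τ => affSnd K (fA (affMk s τ, affMk (s * y) 0)))
          (affSnd K (delta1 K fA (affMk s 0) (affMk (s * y) 0) (affMk 0 1))) 0 :=
        (affSnd K).hasFDerivAt.comp_hasDerivAt 0 (hdA.hasFDerivAt.comp_hasDerivAt 0 hline)
      have hB : HasDerivAt (fun τ => affSnd K (fB (affMk s 0, affMk (s * y) τ)))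
          (affSnd K (delta2 K fB (affMk s 0) (affMk (s * y) 0) (affMk 0 1))) 0 :=
        (affSnd K).hasFDerivAt.comp_hasDerivAt 0 (hdB.hasFDerivAt.comp_hasDerivAt 0 hline')
      have hUA : ∀ᶠ τ in nhds (0 : K), (affMk s τ, affMk (s * y) 0) ∈ U :=
        (hline.continuousAt.prodMk continuousAt_const).eventually (hU.isOpen.mem_nhds hsU)
      have hUB : ∀ᶠ τ in nhds (0 : K), (affMk s 0, affMk (s * y) τ) ∈ U :=
        (continuousAt_const.prodMk hline'.continuousAt).eventually (hU.isOpen.mem_nhds hsU)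
      have hsA := hasSum_of_hasDerivAt (c := fun n => s ^ n * sndCoeff ρ β p y 1 0 n)
        (hUA.mono fun τ hτ => ((hp _ _ _ _ _ (hs _ _ hτ).1).2).congr_fun fun n => by
          simp only [sndCoeff]; split_ifs <;> ring) hA
      have hsB := hasSum_of_hasDerivAt (c := fun n => s ^ n * sndCoeff α γ q y 0 1 n)
        (hUB.mono fun τ hτ => ((hq _ _ _ _ _ (hs _ _ hτ).2).2).congr_fun fun n => by
          simp only [sndCoeff]; split_ifs <;> ring) hB
      refine (hsA.add (hsB.mul_left y)).congr_fun fun n => ?_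
      rw [PowerSeries.coeff_mk]; ring
    refine (HasEval.X.mul key).congr (Filter.Eventually.of_forall fun s => ?_)
    have e (x : K) (T : AffLie K →L[K] AffLie K) :
        tr (adL K (affMk x 0) * T) = x * affSnd K (T (affMk 0 1)) := by
      rw [tr_affLie, mul_apply_eq_comp, mul_apply_eq_comp, ← affMk_eta (T (affMk 1 0)),
        ← affMk_eta (T (affMk 0 1)), adL_affMk, adL_affMk]
      simp
    have e' (S T : AffLie K →L[K] AffLie K) : tr (S + T) = tr S + tr T := by simp [tr]
    simp only [e, e']
    ring
  have hr : HasEval (PowerSeries.mk fun n =>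
      PowerSeries.coeff n (psi K) * (1 + y ^ n - (1 + y) ^ n))
      (fun s => tr (adL K (affMk s 0) * delta1 K fA (affMk s 0) (affMk (s * y) 0) +
        adL K (affMk (s * y) 0) * delta2 K fB (affMk s 0) (affMk (s * y) 0))) := by
    filter_upwards [hnear] with s hsU
    rw [hU.trace_eq _ _ hsU]
    obtain ⟨c1, c2, c3⟩ := hU.converges _ _ hsU
    rw [affExp_mul_affExp_of_snd_eq_zero] at c3 ⊢
    have e (R S T : AffLie K →L[K] AffLie K) : tr (R + S - T) = tr R + tr S - tr T := by
      simp [tr]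
    rw [e]
    refine (((hasSum_tr_evalAt hψ0 c1).add (hasSum_tr_evalAt hψ0 c2)).sub
      (hasSum_tr_evalAt hψ0 c3)).congr_fun fun n => ?_
    rw [PowerSeries.coeff_mk, show s + s * y = s * (1 + y) by ring, mul_pow, mul_pow]
    ring
  have := congrArg (PowerSeries.coeff (n + 1)) (hl.unique hr)
  rwa [PowerSeries.coeff_succ_X_mul, PowerSeries.coeff_mk, PowerSeries.coeff_mk] at this

end Equations

/-! ### The coefficients of a universal solution -/

section Coefficients

variable {K : Type u} [RCLike K]

theorem coeff_zero_phiOne : PowerSeries.coeff 0 (phiOne K) = 1 := by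
  simp [phiOne, bernoulliPowerSeries]

theorem coeff_one_phiOne : PowerSeries.coeff 1 (phiOne K) = -1 / 2 := by
  simp [phiOne, bernoulliPowerSeries, bernoulli_one]

theorem X_mul_phiOneShift : PowerSeries.X * phiOneShift K = phiOne K - 1 := by
  ext n
  rcases n with _ | n
  · rw [map_sub, coeff_zero_phiOne]; simp
  · rw [PowerSeries.coeff_succ_X_mul]
    simp [phiOneShift, PowerSeries.coeff_one]

theorem constantCoeff_betaSeries (α : K) :
    PowerSeries.constantCoeff (betaSeries α) = α - 1 / 2 := by
  have h : PowerSeries.constantCoeff (PowerSeries.evalNegHom (phiOne K)) = 1 := by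
    rw [← PowerSeries.coeff_zero_eq_constantCoeff_apply, PowerSeries.evalNegHom,
      PowerSeries.coeff_rescale, coeff_zero_phiOne]
    simp
  have h' : PowerSeries.constantCoeff (phiOneShift K) = -1 / 2 := by
    rw [← PowerSeries.coeff_zero_eq_constantCoeff_apply, phiOneShift, PowerSeries.coeff_mk,
      coeff_one_phiOne]
  rw [betaSeries, map_mul, map_add, h, h', PowerSeries.constantCoeff_C]
  ring

theorem eq_betaSeries_of_exp_series_eq {α : K} {β : PowerSeries K}
    (h : PowerSeries.X - (PowerSeries.exp K - 1) =
      (PowerSeries.exp K - 1) * (1 - PowerSeries.evalNegHom (PowerSeries.exp K)) * β -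
        PowerSeries.C α * PowerSeries.X * (PowerSeries.exp K - 1)) :
    β = betaSeries α := by
  have h1 : phiOne K * (PowerSeries.exp K - 1) = PowerSeries.X :=
    bernoulliPowerSeries_mul_exp_sub_one K
  have h2 := congrArg PowerSeries.evalNegHom h1
  rw [map_mul, map_sub, map_one, PowerSeries.evalNegHom_X] at h2
  have hX : (PowerSeries.X : PowerSeries K) ≠ 0 := PowerSeries.X_ne_zero
  have hE : PowerSeries.exp K - 1 ≠ 0 := by
    rintro h0
    rw [h0, mul_zero] at h1
    exact hX h1.symm
  apply mul_left_cancel₀ (mul_ne_zero hE hX)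
  rw [betaSeries]
  have h3 := X_mul_phiOneShift (K := K)
  generalize PowerSeries.evalNegHom (PowerSeries.exp K) = E' at *
  generalize PowerSeries.evalNegHom (phiOne K) = φ' at *
  generalize PowerSeries.exp K = E at *
  generalize phiOne K = φ at *
  linear_combination (-φ') * h + (E - 1) * β * h2 - φ' * (E - 1) * h3 - φ' * h1

variable {A B : ℕ → FreeLie K} {ρ α : K} {β γ : PowerSeries K}

theorem IsUniversalKVSolution.beta_eq (h : IsUniversalKVSolution A B ρ β α γ) :
    β = betaSeries α :=
  eq_betaSeries_of_exp_series_eq h.exp_series_eq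

theorem IsUniversalKVSolution.rho_eq_zero (h : IsUniversalKVSolution A B ρ β α γ) : ρ = 0 := by
  obtain ⟨p, q, hpq⟩ := h.trace_coeff_eq
  simpa [sndCoeff] using hpq 0 0

/-- The terms linear in `y` of `IsUniversalKVSolution.trace_coeff_eq`. -/
theorem IsUniversalKVSolution.coeff_gamma (h : IsUniversalKVSolution A B ρ β α γ) (n : ℕ) :
    PowerSeries.coeff n γ = (if n = 0 then 0 else PowerSeries.coeff n β) +
      PowerSeries.coeff (n + 1) (psi K) * ((if n = 0 then 1 else 0) - (n + 1)) := by
  obtain ⟨p, q, hpq⟩ := h.trace_coeff_eq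
  have hpoly : Polynomial.C (if n = 0 then ρ else 0) -
      Polynomial.X * Polynomial.C (if n = 0 then 0 else PowerSeries.coeff n β) -
      Polynomial.X ^ 2 * p n +
      Polynomial.X * (Polynomial.C (PowerSeries.coeff n γ) + Polynomial.X * q n) =
      Polynomial.C (PowerSeries.coeff (n + 1) (psi K)) *
        (1 + Polynomial.X ^ (n + 1) - (1 + Polynomial.X) ^ (n + 1)) := by
    refine Polynomial.funext fun y => ?_
    have h1 := hpq y n
    simp only [sndCoeff] at h1
    simp only [Polynomial.eval_add, Polynomial.eval_sub, Polynomial.eval_mul, Polynomial.eval_C,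
      Polynomial.eval_X, Polynomial.eval_pow, Polynomial.eval_one]
    rw [← h1]
    split_ifs <;> ring
  -- The coefficient of `y` is the derivative at `y = 0`.
  have hd := congrArg (fun r => r.derivative.eval 0) hpoly
  rcases n with _ | n
  · simp at hd ⊢
    exact hd
  · simp [Polynomial.derivative_pow] at hd ⊢
    linear_combination hd

theorem IsUniversalKVSolution.gamma_eq (h : IsUniversalKVSolution A B ρ β α γ) :
    γ = betaSeries α - PowerSeries.C (PowerSeries.constantCoeff (betaSeries α))
      + PowerSeries.C (PowerSeries.constantCoeff (PowerSeries.derivative K (psi K)))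
      - PowerSeries.derivative K (psi K) := by
  ext n
  rw [h.coeff_gamma, h.beta_eq]
  rcases n with _ | n
  · simp
  · simp [PowerSeries.coeff_derivative]
    ring

theorem littleOY_one : littleOY K 1 = ⊥ := by
  rw [littleOY, Submodule.span_eq_bot]
  rintro w ⟨l, i, j, hij, hn, -⟩
  omega

theorem HasExpansion.one_eq {F : ℕ → FreeLie K} {c : K} {ξ : PowerSeries K}
    (h : HasExpansion F c ξ) : F 1 = c • genX K + PowerSeries.coeff 0 ξ • genY K := by
  have h1 := h.2 0
  rw [zero_add, littleOY_one, Submodule.mem_bot, sub_eq_zero, if_pos rfl] at h1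
  exact h1

/-- In total degree one the symmetry reads `β(0) = -α`, whereas `β_α(0) = α - 1 / 2`. -/
theorem IsUniversalKVSolution.alpha_eq_of_isSymmetric (h : IsUniversalKVSolution A B ρ β α γ)
    (hs : IsSymmetric A B) : α = 1 / 4 := by
  -- Evaluate at `X = 0`, `Y = (0, 1)` to isolate the coefficient of `Y`.
  have h1 := congrArg (FreeLieAlgebra.lift K ![affMk 0 0, affMk (0 : K) 1]) (hs 1).1
  have hX : swapNeg K (genX K) = -genY K := by simp [swapNeg, genX]
  have hY : swapNeg K (genY K) = -genX K := by simp [swapNeg, genY]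
  rw [h.expansion_A.one_eq, h.expansion_B.one_eq, map_add, map_smul, map_smul, hX, hY] at h1
  simp only [map_add, map_smul, map_neg, lift_genX, lift_genY] at h1
  have h2 := congrArg (affSnd K) h1
  simp only [map_add, map_smul, map_neg, affSnd_affMk] at h2
  have h3 := constantCoeff_betaSeries α
  rw [← h.beta_eq, ← PowerSeries.coeff_zero_eq_constantCoeff_apply] at h3
  rw [h3] at h2
  simp only [smul_eq_mul] at h2
  linear_combination (-1 / 2) * h2

theorem HasExpansion.sub_mem_littleOY {F F' : ℕ → FreeLie K} {c : K} {ξ : PowerSeries K}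
    (h : HasExpansion F c ξ) (h' : HasExpansion F' c ξ) (n : ℕ) :
    F n - F' n ∈ littleOY K n := by
  rcases n with _ | n
  · rw [h.1, h'.1, sub_zero]
    exact zero_mem _
  · simpa using sub_mem (h.2 n) (h'.2 n)

end Coefficients

end KashiwaraVergne
end

open KashiwaraVergne in
theorem theorem4p1 (K : Type u) [RCLike K] :
    -- every universal solution: `ρ = 0`, `β = β_α`, and `γ = γ_α` is determined by `α`
    (∀ (A B : ℕ → FreeLie K) (ρ : K) (β : PowerSeries K) (α : K) (γ : PowerSeries K),
      IsUniversalKVSolution A B ρ β α γ →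
        ρ = 0 ∧ β = betaSeries α ∧
        γ = betaSeries α - PowerSeries.C (PowerSeries.constantCoeff (betaSeries α))
          + PowerSeries.C (PowerSeries.constantCoeff (PowerSeries.derivative K (psi K)))
          - PowerSeries.derivative K (psi K)) ∧
    -- symmetric universal solutions have `α = 1 / 4`
    (∀ (A B : ℕ → FreeLie K) (ρ : K) (β : PowerSeries K) (α : K) (γ : PowerSeries K),
      IsUniversalKVSolution A B ρ β α γ → IsSymmetric A B → α = 1 / 4) ∧
    -- the symmetric universal solution is unique up to order one in `Y`
    (∀ (A B A' B' : ℕ → FreeLie K) (ρ ρ' : K) (β β' : PowerSeries K) (α α' : K)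
      (γ γ' : PowerSeries K),
      IsUniversalKVSolution A B ρ β α γ → IsSymmetric A B →
      IsUniversalKVSolution A' B' ρ' β' α' γ' → IsSymmetric A' B' →
        (ρ = ρ' ∧ β = β' ∧ α = α' ∧ γ = γ') ∧
        ∀ n, A n - A' n ∈ littleOY K n ∧ B n - B' n ∈ littleOY K n) := by
  refine ⟨fun A B ρ β α γ h => ⟨h.rho_eq_zero, h.beta_eq, h.gamma_eq⟩,
    fun A B ρ β α γ h hs => h.alpha_eq_of_isSymmetric hs,
    fun A B A' B' ρ ρ' β β' α α' γ γ' h hs h' hs' => ?_⟩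
  have hα : α = α' :=
    (h.alpha_eq_of_isSymmetric hs).trans (h'.alpha_eq_of_isSymmetric hs').symm
  have hρ : ρ = ρ' := h.rho_eq_zero.trans h'.rho_eq_zero.symm
  have hβ : β = β' := by rw [h.beta_eq, h'.beta_eq, hα]
  have hγ : γ = γ' := by rw [h.gamma_eq, h'.gamma_eq, hα]
  subst hα hρ hβ hγ
  exact ⟨⟨rfl, rfl, rfl, rfl⟩, fun n => ⟨h.expansion_A.sub_mem_littleOY h'.expansion_A n,
    h.expansion_B.sub_mem_littleOY h'.expansion_B n⟩⟩
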